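/- For $x\in\mathbb{C}$ and an integer $n\ge 0$ let $(x)_n=x(x+1)\cdots(x+n-1)$ (with $(x)_0=1$), and for complex $k$ let $(x)_k=\Gamma(x+k)/\Gamma(x)$. (i) For every $k\in\mathbb{C}$ such that $2k$ is not a negative integer, $$\sum_{n=0}^{\infty}\left(\frac12\right)^n\frac{\left(\frac12+k\right)_n\left(\frac13\right)_n\left(\frac23\right)_n}{(1+k)_n(1+2k)_n(1)_n}\,(6n+6k+1)=\frac{3\sqrt3}{\pi}\cdot\frac{(1)_k^2}{\left(\frac13\right)_k\left(\frac23\right)_k},$$ where the series converges absolutely, and the right-hand side is read as $0$ (its limiting value, $1/\Gamma$ being entire) when $\frac13+k$ or $\frac23+k$ is a nonpositive integer. (ii) In particular ($k=0$), $$\sum_{n=0}^{\infty}\left(\frac12\right)^n\frac{\left(\frac12\right)_n\left(\frac13\right)_n\left(\frac23\right)_n}{(1)_n^3}\,(6n+1)=\frac{3\sqrt3}{\pi}.$$ (iii) The identity in (i) is WZ-demonstrable in the following sense. Let $D$ be the set of $k\in\mathbb{C}$ such that $2k$ is not a negative integer and neither $\frac13+k$ nor $\frac23+k$ is a nonpositive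 integer, and let $G(n,k)$ be the $n$-th summand in (i) multiplied by $\left(\frac13\right)_k\left(\frac23\right)_k/(1)_k^2$. Then there is a function $F(n,k)$ ($n\in\mathbb{Z}_{\ge0}$, $k\in D$) such that $(F,G)$ is a Wilf–Zeilberger pair, i.e. $F$ and $G$ are hypergeometric in both variables (for $A=F,G$ the quotients $A(n+1,k)/A(n,k)$ and $A(n,k+1)/A(n,k)$ are nonzero rational functions of $(n,k)$, in the cross-multiplied sense: $Q\cdot A(n+1,k)=P\cdot A(n,k)$ for nonzero polynomials $P,Q$ in $(n,k)$, and likewise for $A(n,k+1)$) and $$F(n+1,k)-F(n,k)=G(n,k+1)-G(n,k)\qquad(n\ge 0,\ k\in D),$$ with, moreover, $F(0,k)=0$ and $\lim_{n\to\infty}F(n,k)=0$ for every $k\in D$. -/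

import Mathlib

open Filter Topology

noncomputable section

/-- The rising factorial `(x)_n = x (x + 1) ⋯ (x + n - 1)`, `(x)_0 = 1`. -/
def risingFac (x : ℂ) (n : ℕ) : ℂ := (ascPochhammer ℂ n).eval x

/-- The generalized Pochhammer symbol `(x)_k = Γ(x + k) / Γ(x)` for complex `k`. -/
def pochGamma (x k : ℂ) : ℂ := Complex.Gamma (x + k) / Complex.Gamma x

/-- The `n`-th summand
`(1/2)^n (1/2+k)_n (1/3)_n (2/3)_n / ((1+k)_n (1+2k)_n (1)_n) * (6n+6k+1)`. -/
def summand (n : ℕ) (k : ℂ) : ℂ :=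
  (1 / 2) ^ n *
    (risingFac (1 / 2 + k) n * risingFac (1 / 3) n * risingFac (2 / 3) n /
      (risingFac (1 + k) n * risingFac (1 + 2 * k) n * risingFac 1 n)) *
    (6 * n + 6 * k + 1)

/-- `(1/3)_k (2/3)_k / (1)_k^2`. -/
def factorD (k : ℂ) : ℂ := pochGamma (1 / 3) k * pochGamma (2 / 3) k / pochGamma 1 k ^ 2

/-- All complex `k` for which every rising factorial and every Pochhammer symbol in the identity is
defined and every denominator is nonzero: neither `2k` is a negative integer, nor `1/3 + k` or
`2/3 + k` a nonpositive integer. -/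
def wzDomain : Set ℂ :=
  {k | ∀ m : ℕ, 2 * k ≠ -((m : ℂ) + 1) ∧ 1 / 3 + k ≠ -(m : ℂ) ∧ 2 / 3 + k ≠ -(m : ℂ)}

/-- `A(n, k)`, for `n ∈ ℕ` and `k ∈ D`, is hypergeometric in its two variables: the quotients
`A(n+1,k)/A(n,k)` and `A(n,k+1)/A(n,k)` are rational functions of `(n, k)`. The quotients are
written cross-multiplied since `A` may have zeros. -/
def IsHypergeometric (D : Set ℂ) (A : ℕ → ℂ → ℂ) : Prop :=
  ∃ P₁ Q₁ P₂ Q₂ : MvPolynomial (Fin 2) ℂ, P₁ ≠ 0 ∧ Q₁ ≠ 0 ∧ P₂ ≠ 0 ∧ Q₂ ≠ 0 ∧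
    ∀ n : ℕ, ∀ k ∈ D,
      MvPolynomial.eval ![(n : ℂ), k] Q₁ * A (n + 1) k =
        MvPolynomial.eval ![(n : ℂ), k] P₁ * A n k ∧
      MvPolynomial.eval ![(n : ℂ), k] Q₂ * A n (k + 1) =
        MvPolynomial.eval ![(n : ℂ), k] P₂ * A n k

/-- A Wilf–Zeilberger pair on `ℕ × D`. -/
def IsWZPair (D : Set ℂ) (F G : ℕ → ℂ → ℂ) : Prop :=
  IsHypergeometric D F ∧ IsHypergeometric D G ∧
    ∀ n : ℕ, ∀ k ∈ D, F (n + 1) k - F n k = G n (k + 1) - G n k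

/-- `G` is the second member of a WZ-pair `(F, G)` on `ℕ × D` whose first member vanishes at `n = 0`
and tends to `0` as `n → ∞`. -/
def IsWZSummand (D : Set ℂ) (G : ℕ → ℂ → ℂ) : Prop :=
  ∃ F : ℕ → ℂ → ℂ, IsWZPair D F G ∧ (∀ k ∈ D, F 0 k = 0) ∧
    ∀ k ∈ D, Tendsto (fun n => F n k) atTop (𝓝 0)

end

open Filter Topology

noncomputable section

/-! Write `S k` for the sum of the series. Summing the WZ equation `mate_succ_sub` over `n`
telescopes: `mate` vanishes at `n = 0` and tends to 0, so `S k = factorRatio k * S (k + 1)`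
(`tsum_summand_eq`). As `factorRatio` is the quotient of consecutive values of `factorD`, the
product `factorD k * S k` has period 1 on `wzDomain`. Its value is found by shifting `k` to infinity
along the integers. By Euler's limit for Gamma and the reflection formula, `factorD (k + N)` is
asymptotic to `√3 / (2πN)` (`tendsto_mul_factorD`), while `S (k + N)` is asymptotic to `6N`, since
only the term `n = 0` survives division by `N` (`tendsto_tsum_div`). The product is `3√3 / π`. At
the excluded points of `wzDomain` where `2k` is still no negative integer, the recurrence reaches a
zero of `factorRatio`, so `S k = 0`. -/

namespace WZSeries

/-- `2k` is not a negative integer. -/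
def Admissible (k : ℂ) : Prop := ∀ m : ℕ, 2 * k ≠ -((m : ℂ) + 1)

/-- The hypergeometric term of `summand`, without its linear factor `6n + 6k + 1`. -/
def hypTerm (n : ℕ) (k : ℂ) : ℂ :=
  (1 / 2) ^ n *
    (risingFac (1 / 2 + k) n * risingFac (1 / 3) n * risingFac (2 / 3) n /
      (risingFac (1 + k) n * risingFac (1 + 2 * k) n * risingFac 1 n))

/-- The WZ mate of `summand`, before the multiplication by `factorD`. -/
def mate (n : ℕ) (k : ℂ) : ℂ :=
  n * (12 * n + 12 * k + 8) / (1 + 2 * k + n) * hypTerm n k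

/-- The quotient `factorD (k + 1) / factorD k`. -/
def factorRatio (k : ℂ) : ℂ := (1 / 3 + k) * (2 / 3 + k) / (1 + k) ^ 2

/-! ### Rising factorials and the shifts of the hypergeometric term -/

theorem summand_eq (n : ℕ) (k : ℂ) : summand n k = hypTerm n k * (6 * n + 6 * k + 1) := rfl

theorem risingFac_zero (x : ℂ) : risingFac x 0 = 1 := by simp [risingFac]

theorem risingFac_succ (x : ℂ) (n : ℕ) : risingFac x (n + 1) = risingFac x n * (x + n) := by
  simp [risingFac, ascPochhammer_succ_eval]

theorem risingFac_shift (x : ℂ) (n : ℕ) : x * risingFac (x + 1) n = risingFac x n * (x + n) := by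
  induction n with
  | zero => simp [risingFac_zero]
  | succ n ih =>
    rw [risingFac_succ, risingFac_succ, ← mul_assoc, ih]
    push_cast
    ring

theorem risingFac_ne_zero {x : ℂ} (hx : ∀ j : ℕ, x + j ≠ 0) (n : ℕ) : risingFac x n ≠ 0 := by
  induction n with
  | zero => simp [risingFac_zero]
  | succ n ih => rw [risingFac_succ]; exact mul_ne_zero ih (hx n)

theorem Admissible.add_one {k : ℂ} (hk : Admissible k) : Admissible (k + 1) := by
  intro m h
  apply hk (m + 2)
  push_cast
  linear_combination h

theorem Admissible.one_add_two_mul {k : ℂ} (hk : Admissible k) (n : ℕ) : 1 + 2 * k + n ≠ 0 :=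
  fun h => hk n (by linear_combination h)

theorem Admissible.one_add {k : ℂ} (hk : Admissible k) (n : ℕ) : 1 + k + n ≠ 0 :=
  fun h => hk (2 * n + 1) (by push_cast; linear_combination 2 * h)

theorem Admissible.half_add {k : ℂ} (hk : Admissible k) (n : ℕ) : 1 / 2 + k + n ≠ 0 :=
  fun h => hk (2 * n) (by push_cast; linear_combination 2 * h)

theorem ofReal_add_natCast_ne_zero {x : ℝ} (hx : 0 < x) (n : ℕ) : (x : ℂ) + n ≠ 0 := by
  have : (x + n : ℝ) ≠ 0 := by positivity
  exact_mod_cast this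

theorem one_add_natCast_ne_zero (n : ℕ) : (1 : ℂ) + n ≠ 0 := by
  simpa using ofReal_add_natCast_ne_zero one_pos n

theorem hypTerm_zero (k : ℂ) : hypTerm 0 k = 1 := by simp [hypTerm, risingFac_zero]

theorem hypTerm_succ (n : ℕ) (k : ℂ) :
    hypTerm (n + 1) k = 1 / 2 * ((1 / 2 + k + n) / (1 + k + n)) *
      ((1 / 3 + n) / (1 + 2 * k + n)) * ((2 / 3 + n) / (1 + n)) * hypTerm n k := by
  simp only [hypTerm, risingFac_succ, pow_succ, div_eq_mul_inv, mul_inv]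
  ring

theorem hypTerm_ne_zero {k : ℂ} (hk : Admissible k) (n : ℕ) : hypTerm n k ≠ 0 := by
  have h3 : ∀ j : ℕ, (1 / 3 : ℂ) + j ≠ 0 := fun j => by
    simpa using ofReal_add_natCast_ne_zero (x := 1 / 3) (by norm_num) j
  have h4 : ∀ j : ℕ, (2 / 3 : ℂ) + j ≠ 0 := fun j => by
    simpa using ofReal_add_natCast_ne_zero (x := 2 / 3) (by norm_num) j
  have h2 : ((1 : ℂ) / 2) ^ n ≠ 0 := pow_ne_zero n (by norm_num)
  exact mul_ne_zero h2 (div_ne_zero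
    (mul_ne_zero (mul_ne_zero (risingFac_ne_zero hk.half_add n) (risingFac_ne_zero h3 n))
      (risingFac_ne_zero h4 n))
    (mul_ne_zero (mul_ne_zero (risingFac_ne_zero hk.one_add n)
      (risingFac_ne_zero hk.one_add_two_mul n)) (risingFac_ne_zero one_add_natCast_ne_zero n)))

theorem hypTerm_add_one {k : ℂ} (hk : Admissible k) (n : ℕ) :
    hypTerm n (k + 1) = 4 * (1 / 2 + k + n) * (1 + k) ^ 2 /
      ((1 + k + n) * (1 + 2 * k + n) * (2 + 2 * k + n)) * hypTerm n k := by
  have a0 : 1 / 2 + k ≠ 0 := by simpa using hk.half_add 0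
  have b0 : 1 + k ≠ 0 := by simpa using hk.one_add 0
  have c0 : 1 + 2 * k ≠ 0 := by simpa using hk.one_add_two_mul 0
  have d0 : 2 + 2 * k ≠ 0 := fun h => b0 (by linear_combination h / 2)
  have bn := hk.one_add n
  have cn := hk.one_add_two_mul n
  have dn : 2 + 2 * k + n ≠ 0 := fun h => hk.one_add_two_mul (n + 1) (by
    push_cast; linear_combination h)
  have eA : risingFac (1 / 2 + (k + 1)) n = risingFac (1 / 2 + k) n * (1 / 2 + k + n) /
      (1 / 2 + k) := by
    rw [eq_div_iff a0, ← risingFac_shift, ← add_assoc]; ring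
  have eB : risingFac (1 + (k + 1)) n = risingFac (1 + k) n * (1 + k + n) / (1 + k) := by
    rw [eq_div_iff b0, ← risingFac_shift, ← add_assoc]; ring
  -- The base `1 + 2k` moves by 2, hence two unit shifts.
  have eC : risingFac (1 + 2 * (k + 1)) n = risingFac (1 + 2 * k) n * (1 + 2 * k + n) *
      (2 + 2 * k + n) / ((1 + 2 * k) * (2 + 2 * k)) := by
    have h1 := risingFac_shift (1 + 2 * k) n
    have h2 := risingFac_shift (1 + 2 * k + 1) n
    rw [show 1 + 2 * k + 1 + 1 = 1 + 2 * (k + 1) by ring] at h2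
    rw [eq_div_iff (mul_ne_zero c0 d0)]
    linear_combination (1 + 2 * k) * h2 + (2 + 2 * k + n) * h1
  have := risingFac_ne_zero hk.one_add n
  have := risingFac_ne_zero hk.one_add_two_mul n
  have := risingFac_ne_zero one_add_natCast_ne_zero n
  simp only [hypTerm, eA, eB, eC]
  have a0' : 1 + k * 2 ≠ 0 := by rwa [mul_comm k]
  field_simp
  ring

/-- The WZ equation for `summand`, free of Gamma factors. -/
theorem mate_succ_sub {k : ℂ} (hk : Admissible k) (n : ℕ) :
    mate (n + 1) k - mate n k = factorRatio k * summand n (k + 1) - summand n k := by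
  have b0 : 1 + k ≠ 0 := by simpa using hk.one_add 0
  have bn := hk.one_add n
  have cn := hk.one_add_two_mul n
  have dn : 2 + 2 * k + n ≠ 0 := fun h => hk.one_add_two_mul (n + 1) (by
    push_cast; linear_combination h)
  have en := one_add_natCast_ne_zero n
  rw [summand_eq, summand_eq, mate, mate, factorRatio, hypTerm_succ, hypTerm_add_one hk]
  push_cast
  rw [show 1 + 2 * k + ((n : ℂ) + 1) = 2 + 2 * k + n by ring]
  generalize hc : 1 + 2 * k + (n : ℂ) = c at cn ⊢
  generalize hd : 2 + 2 * k + (n : ℂ) = d at dn ⊢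
  field_simp
  subst hc hd
  ring

/-! ### Convergence of the series and decay of the mate -/

theorem tendsto_add_natCast_div (a b : ℂ) :
    Tendsto (fun n : ℕ => (a + n) / (b + n)) atTop (𝓝 1) := by
  have h := (tendsto_const_nhds (x := a)).mul (tendsto_inv_atTop_nhds_zero_nat (𝕜 := ℂ))
  have h' := (tendsto_const_nhds (x := b)).mul (tendsto_inv_atTop_nhds_zero_nat (𝕜 := ℂ))
  have := (h.add_const 1).div (h'.add_const 1) (by simp)
  refine (this.congr' ?_).trans (by simp)
  filter_upwards [eventually_ne_atTop 0] with n hn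
  have : (n : ℂ) ≠ 0 := by exact_mod_cast hn
  simp only [Pi.div_apply]
  rw [← mul_div_mul_right _ _ this, add_mul, add_mul, mul_assoc, mul_assoc, inv_mul_cancel₀ this]
  simp

/-- The weight `1 + n` dominates both the linear factor of `summand` and the growth of the prefactor
in `mate`, so one ratio test, with limit 1/2, serves for both. -/
theorem summable_mul_hypTerm {k : ℂ} (hk : Admissible k) :
    Summable fun n : ℕ => ‖(1 + n) * hypTerm n k‖ := by
  have hne : ∀ n : ℕ, (1 + n) * hypTerm n k ≠ 0 := fun n =>
    mul_ne_zero (one_add_natCast_ne_zero n) (hypTerm_ne_zero hk n)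
  refine summable_of_ratio_test_tendsto_lt_one (l := 1 / 2) (by norm_num)
    (.of_forall fun n => norm_ne_zero_iff.mpr (hne n)) ?_
  have h := ((((tendsto_add_natCast_div (1 / 2 + k) (1 + k)).const_mul (1 / 2)).mul
    (tendsto_add_natCast_div (1 / 3) (1 + 2 * k))).mul (tendsto_add_natCast_div (2 / 3) 1)).mul
    (tendsto_add_natCast_div 2 1)
  have h2 := h.norm
  simp only [norm_mul, norm_div] at h2
  norm_num at h2
  refine h2.congr fun n => ?_
  have ht := hypTerm_ne_zero hk n
  have hn := one_add_natCast_ne_zero n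
  have e : ∀ r t : ℂ, t ≠ 0 → (1 + ((n + 1 : ℕ) : ℂ)) * (r * t) / ((1 + n) * t) =
      r * ((2 + n) / (1 + n)) := fun r t ht => by
    push_cast
    field_simp
    ring
  rw [norm_norm, norm_norm, hypTerm_succ, eq_comm, ← norm_div, e _ _ ht]
  simp only [norm_mul, norm_div]
  norm_num

theorem norm_linear_le (a b : ℂ) (n : ℕ) : ‖a * n + b‖ ≤ (‖a‖ + ‖b‖) * ‖(1 + n : ℂ)‖ := by
  have h : ‖(1 + n : ℂ)‖ = 1 + n := by
    rw [show (1 + n : ℂ) = ((1 + n : ℕ) : ℂ) by push_cast; rfl, Complex.norm_natCast]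
    push_cast; rfl
  have h1 := norm_add_le (a * n) b
  rw [norm_mul, Complex.norm_natCast] at h1
  rw [h]
  nlinarith [norm_nonneg a, norm_nonneg b, mul_nonneg (norm_nonneg b) (Nat.cast_nonneg (α := ℝ) n)]

theorem summable_summand {k : ℂ} (hk : Admissible k) : Summable fun n => summand n k := by
  refine Summable.of_norm_bounded
    ((summable_mul_hypTerm hk).mul_left (‖(6 : ℂ)‖ + ‖6 * k + 1‖)) fun n => ?_
  rw [summand_eq, add_assoc, norm_mul, norm_mul, mul_comm, ← mul_assoc]
  exact mul_le_mul_of_nonneg_right (norm_linear_le _ _ _) (norm_nonneg _)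

theorem mate_zero (k : ℂ) : mate 0 k = 0 := by simp [mate]

theorem tendsto_mate {k : ℂ} (hk : Admissible k) : Tendsto (fun n => mate n k) atTop (𝓝 0) := by
  have h1 : Tendsto (fun n : ℕ => (1 + n) * hypTerm n k) atTop (𝓝 0) :=
    tendsto_zero_iff_norm_tendsto_zero.mpr (summable_mul_hypTerm hk).tendsto_atTop_zero
  -- `mate` is `n/(1+2k+n) * 12(k+2/3+n)/(1+n)`, which tends to 12, times `(1+n) * hypTerm`.
  have h2 := ((tendsto_add_natCast_div 0 (1 + 2 * k)).mul
    ((tendsto_add_natCast_div (k + 2 / 3) 1).const_mul 12)).mul h1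
  rw [mul_zero] at h2
  refine h2.congr fun n => ?_
  have := one_add_natCast_ne_zero n
  have := hk.one_add_two_mul n
  rw [mate]
  field_simp
  ring

/-! ### Telescoping and periodicity -/

theorem tsum_summand_eq {k : ℂ} (hk : Admissible k) :
    ∑' n, summand n k = factorRatio k * ∑' n, summand n (k + 1) := by
  have h1 := (summable_summand hk.add_one).hasSum.mul_left (factorRatio k)
  have h2 := (h1.sub (summable_summand hk).hasSum).tendsto_sum_nat
  have h3 : ∀ N, ∑ n ∈ Finset.range N, (factorRatio k * summand n (k + 1) - summand n k) =
      mate N k := fun N => by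
    rw [← Finset.sum_congr rfl fun n _ => mate_succ_sub hk n,
      Finset.sum_range_sub (fun n => mate n k), mate_zero, sub_zero]
  have h4 := tendsto_nhds_unique (h2.congr h3) (tendsto_mate hk)
  exact (sub_eq_zero.mp h4).symm

/-- `factorRatio` vanishes at `k = -x`; the recurrence carries this zero to `-x - m`. -/
theorem tsum_summand_eq_zero {x : ℂ} (hx : x = 1 / 3 ∨ x = 2 / 3) (m : ℕ) :
    ∀ k : ℂ, Admissible k → x + k = -m → ∑' n, summand n k = 0 := by
  induction m with
  | zero =>
    intro k hk h
    rw [tsum_summand_eq hk, factorRatio]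
    rw [Nat.cast_zero, neg_zero] at h
    rcases hx with rfl | rfl <;> rw [h] <;> ring
  | succ m ih =>
    intro k hk h
    rw [tsum_summand_eq hk, ih (k + 1) hk.add_one (by push_cast at h; linear_combination h),
      mul_zero]

theorem pochGamma_add_one {x k : ℂ} (h : x + k ≠ 0) :
    pochGamma x (k + 1) = (x + k) * pochGamma x k := by
  rw [pochGamma, pochGamma, ← add_assoc, Complex.Gamma_add_one _ h, mul_div_assoc]

theorem factorD_add_one {k : ℂ} (h1 : 1 + k ≠ 0) (h2 : 1 / 3 + k ≠ 0) (h3 : 2 / 3 + k ≠ 0) :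
    factorD (k + 1) = factorRatio k * factorD k := by
  rw [factorD, factorD, factorRatio, pochGamma_add_one h1, pochGamma_add_one h2,
    pochGamma_add_one h3, mul_pow]
  simp only [div_eq_mul_inv, mul_inv]
  ring

theorem admissible_of_mem {k : ℂ} (hk : k ∈ wzDomain) : Admissible k := fun m => (hk m).1

theorem factorD_add_one_of_mem {k : ℂ} (hk : k ∈ wzDomain) :
    factorD (k + 1) = factorRatio k * factorD k :=
  factorD_add_one (by simpa using (admissible_of_mem hk).one_add 0) (by simpa using (hk 0).2.1)
    (by simpa using (hk 0).2.2)

theorem add_one_mem_wzDomain {k : ℂ} (hk : k ∈ wzDomain) : k + 1 ∈ wzDomain := by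
  refine fun m => ⟨(admissible_of_mem hk).add_one m, fun h => (hk (m + 1)).2.1 ?_,
    fun h => (hk (m + 1)).2.2 ?_⟩ <;>
  · push_cast
    linear_combination h

theorem factorD_mul_tsum_add {k : ℂ} (hk : k ∈ wzDomain) (N : ℕ) :
    factorD (k + N) * ∑' n, summand n (k + N) = factorD k * ∑' n, summand n k := by
  have step : ∀ k ∈ wzDomain,
      factorD (k + 1) * ∑' n, summand n (k + 1) = factorD k * ∑' n, summand n k := fun k hk => by
    rw [factorD_add_one_of_mem hk, tsum_summand_eq (admissible_of_mem hk)]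
    ring
  have : k + N ∈ wzDomain ∧
      factorD (k + N) * ∑' n, summand n (k + N) = factorD k * ∑' n, summand n k := by
    induction N with
    | zero => simpa using hk
    | succ N ih =>
      rw [Nat.cast_succ, ← add_assoc]
      exact ⟨add_one_mem_wzDomain ih.1, (step _ ih.1).trans ih.2⟩
  exact this.2

/-! ### Asymptotics of the Gamma factor -/

theorem Gamma_add_natCast_add_one {s : ℂ} (hs : ∀ m : ℕ, s ≠ -m) (n : ℕ) :
    Complex.Gamma (s + (n + 1 : ℕ)) = Complex.Gamma s * ∏ j ∈ Finset.range (n + 1), (s + j) := by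
  generalize n + 1 = l
  induction l with
  | zero => simp
  | succ l ih =>
    rw [Nat.cast_succ, ← add_assoc,
      Complex.Gamma_add_one _ fun h => hs l (eq_neg_of_add_eq_zero_left h), ih,
      Finset.prod_range_succ]
    ring

/-- `Γ(s + n + 1) ~ n^s n!`. -/
theorem tendsto_Gamma_add_div {s : ℂ} (hs : ∀ m : ℕ, s ≠ -m) :
    Tendsto (fun n : ℕ => Complex.Gamma (s + (n + 1 : ℕ)) / ((n : ℂ) ^ s * n.factorial)) atTop
      (𝓝 1) := by
  have h0 := Complex.Gamma_ne_zero hs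
  have h := (Complex.GammaSeq_tendsto_Gamma s).inv₀ h0 |>.const_mul (Complex.Gamma s)
  rw [mul_inv_cancel₀ h0] at h
  refine h.congr fun n => ?_
  rw [Gamma_add_natCast_add_one hs, Complex.GammaSeq, inv_div, mul_div_assoc]

theorem tendsto_mul_factorD {k : ℂ} (hk : k ∈ wzDomain) :
    Tendsto (fun N : ℕ => N * factorD (k + (N + 1 : ℕ))) atTop
      (𝓝 ((Real.sqrt 3 : ℂ) / (2 * Real.pi))) := by
  have ha := tendsto_Gamma_add_div (s := 1 / 3 + k) fun m => (hk m).2.1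
  have hb := tendsto_Gamma_add_div (s := 2 / 3 + k) fun m => (hk m).2.2
  have hc := tendsto_Gamma_add_div (s := 1 + k) fun m h =>
    (admissible_of_mem hk).one_add m (by rw [h]; ring)
  have hG : Complex.Gamma (1 / 3) * Complex.Gamma (2 / 3) = 2 * Real.pi / Real.sqrt 3 := by
    have := Complex.Gamma_mul_Gamma_one_sub (1 / 3)
    rw [show (1 : ℂ) - 1 / 3 = 2 / 3 by norm_num] at this
    rw [this, show (Real.pi : ℂ) * (1 / 3) = ((Real.pi / 3 : ℝ) : ℂ) by push_cast; ring,
      ← Complex.ofReal_sin, Real.sin_pi_div_three]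
    push_cast
    field_simp
  have h := (((ha.mul hb).div (hc.pow 2) (by simp)).const_mul
    (Complex.Gamma (1 / 3) * Complex.Gamma (2 / 3))⁻¹)
  refine (h.congr' ?_).trans (by rw [hG]; simp)
  filter_upwards [eventually_ne_atTop 0] with N hN
  have hN' : (N : ℂ) ≠ 0 := by exact_mod_cast hN
  -- The exponents satisfy `(1/3+k) + (2/3+k) + 1 = 2(1+k)`, which is the source of the factor `N`.
  have hp : (N : ℂ) ^ (1 / 3 + k) * (N : ℂ) ^ (2 / 3 + k) * N = ((N : ℂ) ^ (1 + k)) ^ 2 := by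
    nth_rewrite 3 [← Complex.cpow_one (N : ℂ)]
    rw [← Complex.cpow_add _ _ hN', ← Complex.cpow_add _ _ hN', ← Complex.cpow_nat_mul]
    congr 1
    push_cast
    ring
  have hpa : (N : ℂ) ^ (1 / 3 + k) ≠ 0 := by simp [Complex.cpow_eq_zero_iff, hN]
  have hpb : (N : ℂ) ^ (2 / 3 + k) ≠ 0 := by simp [Complex.cpow_eq_zero_iff, hN]
  have hpc : (N : ℂ) ^ (1 + k) ≠ 0 := by simp [Complex.cpow_eq_zero_iff, hN]
  have hf : (N.factorial : ℂ) ≠ 0 := by exact_mod_cast N.factorial_ne_zero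
  simp only [Pi.div_apply, factorD, pochGamma, Complex.Gamma_one,
    div_one, ← add_assoc]
  generalize Complex.Gamma (1 / 3 + k + (N + 1 : ℕ)) = A
  generalize Complex.Gamma (2 / 3 + k + (N + 1 : ℕ)) = B
  generalize Complex.Gamma (1 + k + (N + 1 : ℕ)) = C
  have key : A / ((N : ℂ) ^ (1 / 3 + k) * N.factorial) * (B / ((N : ℂ) ^ (2 / 3 + k) *
      N.factorial)) / (C / ((N : ℂ) ^ (1 + k) * N.factorial)) ^ 2 = N * (A * B / C ^ 2) := by
    rw [div_pow, mul_pow, ← hp]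
    generalize (N : ℂ) ^ (1 / 3 + k) = u at *
    generalize (N : ℂ) ^ (2 / 3 + k) = v at *
    field_simp
  rw [key]
  simp only [div_eq_mul_inv, mul_inv]
  ring

/-! ### Asymptotics of the shifted sum -/

theorem norm_hypTerm_le {K : ℂ} (hK : 0 ≤ K.re) (n : ℕ) : ‖hypTerm n K‖ ≤ (1 / 2) ^ n := by
  induction n with
  | zero => simp [hypTerm_zero]
  | succ n ih =>
    have hn : (0 : ℝ) ≤ n := n.cast_nonneg
    have h1 : ‖(1 / 2 + K + n) / (1 + K + n)‖ ≤ 1 := by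
      rw [norm_div]
      refine div_le_one_of_le₀ ?_ (norm_nonneg _)
      -- Numerator and denominator have the same imaginary part, so only the real parts matter.
      rw [← sq_le_sq₀ (norm_nonneg _) (norm_nonneg _), ← Complex.normSq_eq_norm_sq,
        ← Complex.normSq_eq_norm_sq, Complex.normSq_apply, Complex.normSq_apply]
      norm_num
      nlinarith
    have h2 : ‖(1 / 3 + n) / (1 + 2 * K + n)‖ ≤ 1 := by
      rw [norm_div]
      refine div_le_one_of_le₀ ?_ (norm_nonneg _)
      have e : ‖(1 / 3 + n : ℂ)‖ = 1 / 3 + n := by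
        rw [show (1 / 3 + n : ℂ) = ((1 / 3 + n : ℝ) : ℂ) by push_cast; rfl, Complex.norm_real,
          Real.norm_of_nonneg (by positivity)]
      refine le_trans ?_ (Complex.re_le_norm _)
      rw [e]
      norm_num
      linarith
    have h3 : ‖(2 / 3 + n : ℂ) / (1 + n)‖ ≤ 1 := by
      rw [show (2 / 3 + n : ℂ) / (1 + n) = (((2 / 3 + n) / (1 + n) : ℝ) : ℂ) by push_cast; rfl,
        Complex.norm_real, Real.norm_of_nonneg (by positivity)]
      exact div_le_one_of_le₀ (by linarith) (by positivity)
    rw [hypTerm_succ, norm_mul, norm_mul, norm_mul, norm_mul, pow_succ, mul_comm]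
    refine mul_le_mul ih ?_ (by positivity) (by positivity)
    rw [show ‖(1 / 2 : ℂ)‖ = 1 / 2 by norm_num]
    calc _ ≤ (1 / 2 : ℝ) * 1 * 1 * 1 := by gcongr
      _ = _ := by norm_num

theorem tendsto_inv_natCast_add (a : ℂ) :
    Tendsto (fun N : ℕ => (a + N : ℂ)⁻¹) atTop (𝓝 0) := by
  have h := (tendsto_add_natCast_div 0 a).mul (tendsto_inv_atTop_nhds_zero_nat (𝕜 := ℂ))
  rw [mul_zero] at h
  refine h.congr' ?_
  filter_upwards [eventually_ne_atTop 0] with n hn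
  have : (n : ℂ) ≠ 0 := by exact_mod_cast hn
  field_simp
  simp

/-- Each step in `n` brings a factor `1/(1+2k+2N+n)`, which tends to 0; the other factors stay
bounded. -/
theorem tendsto_hypTerm_add (k : ℂ) (n : ℕ) :
    Tendsto (fun N : ℕ => hypTerm n (k + N)) atTop (𝓝 (if n = 0 then 1 else 0)) := by
  have hstep : ∀ (n : ℕ) (c : ℂ), Tendsto (fun N : ℕ => hypTerm n (k + N)) atTop (𝓝 c) →
      Tendsto (fun N : ℕ => hypTerm (n + 1) (k + N)) atTop (𝓝 0) := by
    intro n c ih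
    have h1 := tendsto_add_natCast_div (1 / 2 + k + n) (1 + k + n)
    have h2 := tendsto_inv_natCast_add (1 / 2 + k + n / 2)
    have h := (((h1.const_mul (1 / 2)).mul (h2.const_mul ((1 / 3 + n : ℂ) / 2))).mul_const
      ((2 / 3 + n : ℂ) / (1 + n))).mul ih
    rw [mul_zero, mul_zero, zero_mul, zero_mul] at h
    refine h.congr fun N => ?_
    rw [hypTerm_succ, show 1 / 2 + (k + N) + n = 1 / 2 + k + n + (N : ℂ) by ring,
      show 1 + (k + N) + n = 1 + k + n + (N : ℂ) by ring,
      show 1 + 2 * (k + N) + n = 2 * (1 / 2 + k + n / 2 + (N : ℂ)) by ring]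
    simp only [div_eq_mul_inv, mul_inv]
    ring
  cases n with
  | zero => simp [hypTerm_zero]
  | succ n =>
    simp only [Nat.succ_ne_zero, if_false]
    induction n with
    | zero => exact hstep 0 1 (by simp [hypTerm_zero])
    | succ n ih => exact hstep _ _ ih

theorem tendsto_tsum_div (k : ℂ) :
    Tendsto (fun N : ℕ => (∑' n, summand n (k + (N + 1 : ℕ))) / N) atTop (𝓝 6) := by
  have hsum : Summable fun n : ℕ => (6 * n + (‖6 * k + 7‖ + 6)) * (1 / 2 : ℝ) ^ n := by
    have h1 : Summable fun n : ℕ => (n : ℝ) ^ 1 * (1 / 2 : ℝ) ^ n :=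
      summable_pow_mul_geometric_of_norm_lt_one 1 (by norm_num)
    have h0 : Summable fun n : ℕ => (1 / 2 : ℝ) ^ n := summable_geometric_two
    refine ((h1.mul_left 6).add (h0.mul_left (‖6 * k + 7‖ + 6))).congr fun n => ?_
    ring
  have key : Tendsto (fun N : ℕ => ∑' n, summand n (k + (N + 1 : ℕ)) / N) atTop
      (𝓝 (∑' n : ℕ, if n = 0 then (6 : ℂ) else 0)) := by
    refine tendsto_tsum_of_dominated_convergence hsum (fun n => ?_) ?_
    · have h1 := (tendsto_hypTerm_add k n).comp (tendsto_add_atTop_nat 1)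
      have h2 := h1.mul ((tendsto_inv_atTop_nhds_zero_nat (𝕜 := ℂ)).const_mul
        (6 * n + 6 * k + 7) |>.add_const 6)
      refine (h2.congr' ?_).trans (by split_ifs <;> simp)
      filter_upwards [eventually_ne_atTop 0] with N hN
      have : (N : ℂ) ≠ 0 := by exact_mod_cast hN
      rw [summand_eq, mul_div_assoc]
      simp only [Function.comp_apply]
      congr 1
      push_cast
      field_simp
      ring
    -- Beyond `M` the shifted parameter has nonnegative real part, so the geometric bound holds
    -- uniformly in `N`.
    · obtain ⟨M, hM⟩ := exists_nat_ge (-k.re)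
      filter_upwards [eventually_ge_atTop M, eventually_ge_atTop 1] with N hNM hN n
      have hre : 0 ≤ (k + (N + 1 : ℕ)).re := by
        have : (M : ℝ) ≤ N := by exact_mod_cast hNM
        rw [Complex.add_re, Complex.natCast_re]
        push_cast
        linarith
      have hN1 : (1 : ℝ) ≤ N := by exact_mod_cast hN
      rw [summand_eq, norm_div, norm_mul, Complex.norm_natCast, div_le_iff₀ (by linarith)]
      have hlin : ‖6 * (n : ℂ) + 6 * (k + (N + 1 : ℕ)) + 1‖ ≤ (6 * n + (‖6 * k + 7‖ + 6)) * N := by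
        have e : 6 * (n : ℂ) + 6 * (k + (N + 1 : ℕ)) + 1 =
            ((6 * n : ℕ) : ℂ) + (6 * k + 7) + ((6 * N : ℕ) : ℂ) := by push_cast; ring
        have h := norm_add₃_le (a := ((6 * n : ℕ) : ℂ)) (b := 6 * k + 7) (c := ((6 * N : ℕ) : ℂ))
        rw [Complex.norm_natCast, Complex.norm_natCast] at h
        push_cast at h
        rw [e]
        push_cast
        nlinarith [norm_nonneg (6 * k + 7), n.cast_nonneg (α := ℝ),
          mul_nonneg (norm_nonneg (6 * k + 7)) (sub_nonneg.mpr hN1),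
          mul_nonneg (n.cast_nonneg (α := ℝ)) (sub_nonneg.mpr hN1)]
      calc _ ≤ (1 / 2 : ℝ) ^ n * ((6 * n + (‖6 * k + 7‖ + 6)) * N) :=
            mul_le_mul (norm_hypTerm_le hre n) hlin (norm_nonneg _) (by positivity)
        _ = _ := by ring
  rw [tsum_ite_eq] at key
  exact key.congr fun N => tsum_div_const

/-! ### Evaluation of the sum -/

theorem factorD_mul_tsum {k : ℂ} (hk : k ∈ wzDomain) :
    factorD k * ∑' n, summand n k = 3 * (Real.sqrt 3 : ℂ) / (Real.pi : ℂ) := by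
  have h := (tendsto_mul_factorD hk).mul (tendsto_tsum_div k)
  have h' : Tendsto (fun _ : ℕ => factorD k * ∑' n, summand n k) atTop
      (𝓝 ((Real.sqrt 3 : ℂ) / (2 * Real.pi) * 6)) := by
    refine h.congr' ?_
    filter_upwards [eventually_ne_atTop 0] with N hN
    have : (N : ℂ) ≠ 0 := by exact_mod_cast hN
    rw [← factorD_mul_tsum_add hk (N + 1)]
    field_simp
  rw [tendsto_nhds_unique tendsto_const_nhds h']
  have : (Real.pi : ℂ) ≠ 0 := by exact_mod_cast Real.pi_ne_zero
  field_simp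
  norm_num

theorem pochGamma_ne_zero {x k : ℂ} (h0 : ∀ m : ℕ, x ≠ -m) (h : ∀ m : ℕ, x + k ≠ -m) :
    pochGamma x k ≠ 0 :=
  div_ne_zero (Complex.Gamma_ne_zero h) (Complex.Gamma_ne_zero h0)

theorem factorD_ne_zero {k : ℂ} (hk : k ∈ wzDomain) : factorD k ≠ 0 := by
  have hpos : ∀ x : ℝ, 0 < x → ∀ m : ℕ, (x : ℂ) ≠ -m := fun x hx m h =>
    ofReal_add_natCast_ne_zero hx m (by rw [h]; ring)
  refine div_ne_zero (mul_ne_zero (pochGamma_ne_zero ?_ fun m => (hk m).2.1)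
    (pochGamma_ne_zero ?_ fun m => (hk m).2.2)) (pow_ne_zero 2 (pochGamma_ne_zero ?_ fun m h =>
      (admissible_of_mem hk).one_add m (by rw [h]; ring)))
  · simpa using hpos (1 / 3) (by norm_num)
  · simpa using hpos (2 / 3) (by norm_num)
  · simpa using hpos 1 one_pos

theorem hasSum_summand {k : ℂ} (hk : Admissible k) :
    HasSum (fun n : ℕ => summand n k)
      (3 * (Real.sqrt 3 : ℂ) / (Real.pi : ℂ) *
        (pochGamma 1 k ^ 2 / (pochGamma (1 / 3) k * pochGamma (2 / 3) k))) := by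
  refine (summable_summand hk).hasSum_iff.mpr ?_
  have hinv : pochGamma 1 k ^ 2 / (pochGamma (1 / 3) k * pochGamma (2 / 3) k) = (factorD k)⁻¹ := by
    rw [factorD, inv_div]
  by_cases hD : k ∈ wzDomain
  · rw [hinv, ← factorD_mul_tsum hD, mul_comm (factorD k), mul_assoc,
      mul_inv_cancel₀ (factorD_ne_zero hD), mul_one]
  · obtain ⟨m, hm⟩ : ∃ m : ℕ, 1 / 3 + k = -m ∨ 2 / 3 + k = -m := by
      by_contra! hcon
      exact hD fun m => ⟨hk m, hcon m⟩
    rcases hm with hm | hm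
    · rw [tsum_summand_eq_zero (.inl rfl) m k hk hm]
      -- `Complex.Gamma` is 0 at its poles and division by 0 gives 0, which agrees with the limiting
      -- value of the right-hand side.
      simp only [pochGamma, hm, Complex.Gamma_neg_nat_eq_zero]
      simp
    · rw [tsum_summand_eq_zero (.inr rfl) m k hk hm]
      simp only [pochGamma, hm, Complex.Gamma_neg_nat_eq_zero]
      simp

theorem ofReal_ascPochhammer_eval (x : ℝ) (n : ℕ) :
    (((ascPochhammer ℝ n).eval x : ℝ) : ℂ) = risingFac x n := by
  induction n with
  | zero => simp [risingFac]
  | succ n ih => rw [risingFac_succ, ← ih, ascPochhammer_succ_eval]; push_cast; rfl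

theorem hasSum_ramanujan :
    HasSum
      (fun n : ℕ => (1 / 2 : ℝ) ^ n *
        ((ascPochhammer ℝ n).eval (1 / 2) * (ascPochhammer ℝ n).eval (1 / 3) *
          (ascPochhammer ℝ n).eval (2 / 3) / (ascPochhammer ℝ n).eval 1 ^ 3) * (6 * n + 1))
      (3 * Real.sqrt 3 / Real.pi) := by
  have hk : Admissible 0 := fun m h => one_add_natCast_ne_zero m (by linear_combination h)
  have hG : ∀ x : ℝ, 0 < x → pochGamma x 0 = 1 := fun x hx => by
    have hne : Complex.Gamma x ≠ 0 := Complex.Gamma_ne_zero fun m h =>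
      ofReal_add_natCast_ne_zero hx m (by rw [h]; ring)
    rw [pochGamma, add_zero, div_self hne]
  have h1 := hG 1 one_pos
  have h2 := hG (1 / 3) (by norm_num)
  have h3 := hG (2 / 3) (by norm_num)
  push_cast at h1 h2 h3
  have h := hasSum_summand hk
  rw [h1, h2, h3] at h
  rw [← Complex.hasSum_ofReal]
  convert h using 1
  · funext n
    push_cast [ofReal_ascPochhammer_eval]
    simp only [summand, mul_zero, add_zero]
    ring
  · push_cast
    ring

/-! ### The Wilf–Zeilberger pair -/

theorem mvPolynomial_ne_zero {P : MvPolynomial (Fin 2) ℂ}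
    (h : MvPolynomial.eval ![1, 1] P ≠ 0) : P ≠ 0 := by
  rintro rfl
  simp at h

theorem isHypergeometric_summand :
    IsHypergeometric wzDomain fun n k => summand n k * factorD k := by
  open MvPolynomial in
  refine ⟨C (1 / 2) * (C (1 / 2) + X 1 + X 0) * (C (1 / 3) + X 0) * (C (2 / 3) + X 0) *
      (6 * X 0 + 6 * X 1 + 7),
    (1 + X 1 + X 0) * (1 + 2 * X 1 + X 0) * (1 + X 0) * (6 * X 0 + 6 * X 1 + 1),
    4 * (C (1 / 2) + X 1 + X 0) * (C (1 / 3) + X 1) * (C (2 / 3) + X 1) * (6 * X 0 + 6 * X 1 + 7),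
    (1 + X 1 + X 0) * (1 + 2 * X 1 + X 0) * (2 + 2 * X 1 + X 0) * (6 * X 0 + 6 * X 1 + 1),
    mvPolynomial_ne_zero (by norm_num), mvPolynomial_ne_zero (by norm_num),
    mvPolynomial_ne_zero (by norm_num), mvPolynomial_ne_zero (by norm_num), ?_⟩
  intro n k hk
  have hA := admissible_of_mem hk
  have b0 : 1 + k ≠ 0 := by simpa using hA.one_add 0
  have bn := hA.one_add n
  have cn := hA.one_add_two_mul n
  have dn : 2 + 2 * k + n ≠ 0 := fun h => hA.one_add_two_mul (n + 1) (by
    push_cast; linear_combination h)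
  have en := one_add_natCast_ne_zero n
  simp only [summand_eq, factorD_add_one_of_mem hk, factorRatio, hypTerm_succ, hypTerm_add_one hA,
    map_mul, map_add, map_one, map_ofNat, MvPolynomial.eval_C, MvPolynomial.eval_X,
    Matrix.cons_val_zero, Matrix.cons_val_one]
  push_cast
  generalize hc : 1 + 2 * k + (n : ℂ) = c at cn ⊢
  generalize hd : 2 + 2 * k + (n : ℂ) = d at dn ⊢
  constructor <;> field_simp <;> subst hc hd <;> ring

theorem isHypergeometric_mate :
    IsHypergeometric wzDomain fun n k => mate n k * factorD k := by
  open MvPolynomial in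
  -- The factors `1 + n` and `1 + 2k + n` have cancelled in the first quotient. Its denominator
  -- keeps `X 0`; at `n = 0` both sides vanish, as `mate 0 k = 0`.
  refine ⟨C (1 / 2) * (C (1 / 2) + X 1 + X 0) * (C (1 / 3) + X 0) * (C (2 / 3) + X 0) *
      (12 * X 0 + 12 * X 1 + 20),
    (1 + X 1 + X 0) * (2 + 2 * X 1 + X 0) * X 0 * (12 * X 0 + 12 * X 1 + 8),
    4 * (C (1 / 2) + X 1 + X 0) * (C (1 / 3) + X 1) * (C (2 / 3) + X 1) *
      (12 * X 0 + 12 * X 1 + 20),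
    (1 + X 1 + X 0) * (3 + 2 * X 1 + X 0) * (2 + 2 * X 1 + X 0) * (12 * X 0 + 12 * X 1 + 8),
    mvPolynomial_ne_zero (by norm_num), mvPolynomial_ne_zero (by norm_num),
    mvPolynomial_ne_zero (by norm_num), mvPolynomial_ne_zero (by norm_num), ?_⟩
  intro n k hk
  have hA := admissible_of_mem hk
  have b0 : 1 + k ≠ 0 := by simpa using hA.one_add 0
  have bn := hA.one_add n
  have cn := hA.one_add_two_mul n
  have dn : 2 + 2 * k + n ≠ 0 := fun h => hA.one_add_two_mul (n + 1) (by
    push_cast; linear_combination h)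
  have fn : 3 + 2 * k + n ≠ 0 := fun h => hA.one_add_two_mul (n + 2) (by
    push_cast; linear_combination h)
  have en := one_add_natCast_ne_zero n
  simp only [mate, factorD_add_one_of_mem hk, factorRatio, hypTerm_succ, hypTerm_add_one hA,
    map_mul, map_add, map_one, map_ofNat, MvPolynomial.eval_C, MvPolynomial.eval_X,
    Matrix.cons_val_zero, Matrix.cons_val_one]
  push_cast
  rw [show 1 + 2 * k + ((n : ℂ) + 1) = 2 + 2 * k + n by ring,
    show 1 + 2 * (k + 1) + (n : ℂ) = 3 + 2 * k + n by ring]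
  generalize hc : 1 + 2 * k + (n : ℂ) = c at cn ⊢
  generalize hd : 2 + 2 * k + (n : ℂ) = d at dn ⊢
  generalize hf : 3 + 2 * k + (n : ℂ) = f at fn ⊢
  constructor <;> field_simp <;> subst hc hd hf <;> ring

theorem isWZSummand : IsWZSummand wzDomain fun n k => summand n k * factorD k := by
  refine ⟨fun n k => mate n k * factorD k, ⟨isHypergeometric_mate, isHypergeometric_summand,
    fun n k hk => ?_⟩, fun k _ => by simp [mate_zero], fun k hk => ?_⟩
  · beta_reduce
    rw [factorD_add_one_of_mem hk, ← sub_mul, mate_succ_sub (admissible_of_mem hk)]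
    ring
  · simpa using (tendsto_mate (admissible_of_mem hk)).mul_const (factorD k)

end WZSeries

end

theorem mainTheorem4 :
    -- the identity for all complex `k` for which no denominator on the left vanishes
    (∀ k : ℂ, (∀ m : ℕ, 2 * k ≠ -((m : ℂ) + 1)) →
      HasSum (fun n : ℕ => summand n k)
        (3 * (Real.sqrt 3 : ℂ) / (Real.pi : ℂ) *
          (pochGamma 1 k ^ 2 / (pochGamma (1 / 3) k * pochGamma (2 / 3) k)))) ∧
    -- the case `k = 0`, the Ramanujan-type series
    HasSum
      (fun n : ℕ => (1 / 2 : ℝ) ^ n *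
        ((ascPochhammer ℝ n).eval (1 / 2) * (ascPochhammer ℝ n).eval (1 / 3) *
          (ascPochhammer ℝ n).eval (2 / 3) / (ascPochhammer ℝ n).eval 1 ^ 3) * (6 * n + 1))
      (3 * Real.sqrt 3 / Real.pi) ∧
    -- the generalization is WZ-demonstrable
    IsWZSummand wzDomain (fun n k => summand n k * factorD k) :=
  ⟨fun _ hk => WZSeries.hasSum_summand hk, WZSeries.hasSum_ramanujan, WZSeries.isWZSummand⟩
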